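/- Let $\rho>0$ and $\alpha>2$, and let $E$ be an exponential random variable with mean one. For each $n\ge 2$ let the edges $e$ of the complete graph $K_n$ on the vertex set $\{1,\dots,n\}$ carry independent weights $X_e$, each distributed as $e^{-(E/\rho)^{1/\alpha}}$. Let $$W_n=\min_{p}\sum_{e\in p}X_e ,$$ where the minimum runs over all self-avoiding paths $p$ from vertex $1$ to vertex $2$ in $K_n$. Let $F$ be the distribution function of $e^{-(E/\rho)^{1/\alpha}}$, let $u_n$ be the unique positive number with $nF(u_n)=1$ (that is, $u_n=e^{-(\log n/\rho)^{1/\alpha}}$), and put $$s_n=\frac{(\log n)^{-1+1/\alpha}}{\alpha\rho^{1/\alpha}} .$$ Let $(\varepsilon_n)_n$ be any sequence of positive real numbers such that, as $n\to\infty$, $$(\log n)^{-1+2/\alpha}\log\log n=o(\varepsilon_n)\qquad\text{and}\qquad(\log n)^{-1/\alpha}(\log\log n)^3=o(\varepsilon_n).$$ Then $$\lim_{n\to\infty}\mathbb P\bigl(W_n\le(1+\varepsilon_n)\,e\,\lceil s_n\log n\rceil\,u_n\bigr)=1 .$$ -/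

import Mathlib

open MeasureTheory ProbabilityTheory Filter Asymptotics Topology

/-- The law of `exp (-(E / ρ) ^ (1 / α))`, where `E` is exponentially distributed with mean one. -/
noncomputable def edgeLaw (ρ α : ℝ) : Measure ℝ :=
  (expMeasure 1).map (fun t : ℝ => Real.exp (-(t / ρ) ^ (1 / α)))

/-- The weight of a walk: the sum of the weights of its edges. -/
def pathWeight {V : Type*} {G : SimpleGraph V} (x : Sym2 V → ℝ) {a b : V} (p : G.Walk a b) : ℝ :=
  (p.edges.map x).sum

/-- The smallest weight of a self-avoiding path from `a` to `b` in `G`. -/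
noncomputable def minPathWeight {V : Type*} (G : SimpleGraph V) (x : Sym2 V → ℝ) (a b : V) : ℝ :=
  ⨅ p : G.Path a b, pathWeight x (p : G.Walk a b)

/-- The weight `W_n` of the smallest weight path between the first two vertices of the complete
graph on `n` vertices; it is meaningful for `n ≥ 2`, and set to `0` for `n < 2`. -/
noncomputable def optimalWeight (n : ℕ) (x : Sym2 (Fin n) → ℝ) : ℝ :=
  if h : 2 ≤ n then
    minPathWeight (⊤ : SimpleGraph (Fin n)) x ⟨0, by omega⟩ ⟨1, by omega⟩
  else 0

/-- The extreme value scale `u_n`: the positive solution `x` of `n F(x) = 1`, where `F` is the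
distribution function of `μ`. It is written as an infimum; `charScale_unique` shows that for
`μ = edgeLaw ρ α` and `n ≥ 2` there is exactly one solution. -/
noncomputable def charScale (μ : Measure ℝ) (n : ℕ) : ℝ :=
  sInf {x : ℝ | 0 < x ∧ (n : ℝ) * cdf μ x = 1}

/-- The implicit parameter `s_n = (log n) ^ (-1 + 1 / α) / (α ρ ^ (1 / α))`. -/
noncomputable def sParam (ρ α : ℝ) (n : ℕ) : ℝ :=
  Real.log n ^ (-1 + 1 / α) / (α * ρ ^ (1 / α))

theorem measurable_edgeMap (ρ α : ℝ) :
    Measurable (fun t : ℝ => Real.exp (-(t / ρ) ^ (1 / α))) := by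
  fun_prop

theorem expMeasure_ae_nonneg : ∀ᵐ t ∂(expMeasure 1), 0 ≤ t := by
  have := isProbabilityMeasure_expMeasure one_pos
  have h : cdf (expMeasure 1) 0 = 0 := by
    rw [cdf_expMeasure_eq one_pos]; simp
  rw [cdf_eq_real, measureReal_eq_zero_iff] at h
  rw [ae_iff]
  refine measure_mono_null ?_ h
  intro t ht
  exact (not_le.1 ht).le

theorem isProbabilityMeasure_edgeLaw (ρ α : ℝ) : IsProbabilityMeasure (edgeLaw ρ α) := by
  have := isProbabilityMeasure_expMeasure one_pos
  exact Measure.isProbabilityMeasure_map (measurable_edgeMap ρ α).aemeasurable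

theorem cdf_edgeLaw_of_one_le {ρ α x : ℝ} (hρ : 0 < ρ) (hx : 1 ≤ x) :
    cdf (edgeLaw ρ α) x = 1 := by
  have := isProbabilityMeasure_expMeasure one_pos
  have := isProbabilityMeasure_edgeLaw ρ α
  rw [cdf_eq_real, measureReal_def, edgeLaw,
    Measure.map_apply (measurable_edgeMap ρ α) measurableSet_Iic]
  rw [show (expMeasure 1) _ = 1 from ?_, ENNReal.toReal_one]
  rw [prob_compl_eq_zero_iff (measurable_edgeMap ρ α measurableSet_Iic) |>.symm]
  have h := expMeasure_ae_nonneg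
  refine measure_mono_null ?_ (ae_iff.1 h)
  intro t ht h0
  apply ht
  have : 0 ≤ (t / ρ) ^ (1 / α) := Real.rpow_nonneg (div_nonneg h0 hρ.le) _
  simp only [Set.mem_preimage, Set.mem_Iic]
  exact (Real.exp_le_one_iff.2 (by linarith)).trans hx

theorem cdf_edgeLaw_of_lt_one {ρ α x : ℝ} (hρ : 0 < ρ) (hα : 0 < α) (hx0 : 0 < x) (hx1 : x < 1) :
    cdf (edgeLaw ρ α) x = Real.exp (-ρ * (-Real.log x) ^ α) := by
  have := isProbabilityMeasure_expMeasure one_pos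
  have := isProbabilityMeasure_edgeLaw ρ α
  have hL : 0 < -Real.log x := by linarith [Real.log_neg hx0 hx1]
  set c : ℝ := ρ * (-Real.log x) ^ α with hc
  have hc0 : 0 < c := mul_pos hρ (Real.rpow_pos_of_pos hL _)
  have hna : expMeasure 1 {c} = 0 := by
    unfold expMeasure gammaMeasure
    exact withDensity_absolutelyContinuous _ _ (by simp)
  rw [cdf_eq_real, measureReal_def, edgeLaw,
    Measure.map_apply (measurable_edgeMap ρ α) measurableSet_Iic]
  have h1 : ((fun t : ℝ => Real.exp (-(t / ρ) ^ (1 / α))) ⁻¹' Set.Iic x : Set ℝ)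
      =ᵐ[expMeasure 1] (Set.Iic c)ᶜ := by
    have h2 : ∀ᵐ t ∂(expMeasure 1), t ≠ c := by rw [ae_iff]; simpa using hna
    filter_upwards [expMeasure_ae_nonneg, h2] with t ht htc
    have e1 : (Real.exp (-(t / ρ) ^ (1 / α)) ≤ x) ↔ c ≤ t := by
      rw [← Real.le_log_iff_exp_le hx0, neg_le, one_div,
        Real.le_rpow_inv_iff_of_pos hL.le (div_nonneg ht hρ.le) hα, le_div_iff₀ hρ, mul_comm]
    refine propext ?_
    change (Real.exp (-(t / ρ) ^ (1 / α)) ≤ x) ↔ ¬ t ≤ c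
    rw [e1, not_le]
    exact ⟨fun h => lt_of_le_of_ne h (Ne.symm htc), le_of_lt⟩
  have h3 : expMeasure 1 ((fun t : ℝ => Real.exp (-(t / ρ) ^ (1 / α))) ⁻¹' Set.Iic x) =
      expMeasure 1 (Set.Iic c)ᶜ := measure_congr h1
  rw [h3, ← measureReal_def, probReal_compl_eq_one_sub measurableSet_Iic,
    ← cdf_eq_real, cdf_expMeasure_eq one_pos, if_pos hc0.le, hc]
  ring_nf

/-- For `n ≥ 2` the number `exp (-(log n / ρ) ^ (1 / α))` is the unique positive solution. -/
theorem charScale_unique {ρ α : ℝ} (hρ : 0 < ρ) (hα : 0 < α) {n : ℕ} (hn : 2 ≤ n) (x : ℝ) :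
    (0 < x ∧ (n : ℝ) * cdf (edgeLaw ρ α) x = 1) ↔
      x = Real.exp (-(Real.log n / ρ) ^ (1 / α)) := by
  have hn' : (2 : ℝ) ≤ n := by exact_mod_cast hn
  have hn0 : (0 : ℝ) < n := by linarith
  have hlog : 0 < Real.log n := Real.log_pos (by linarith)
  have hq : 0 < Real.log n / ρ := div_pos hlog hρ
  constructor
  · rintro ⟨hx0, hx⟩
    have hx1 : x < 1 := by
      by_contra h
      rw [cdf_edgeLaw_of_one_le hρ (not_lt.1 h)] at hx
      linarith
    have hL : 0 < -Real.log x := by linarith [Real.log_neg hx0 hx1]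
    rw [cdf_edgeLaw_of_lt_one hρ hα hx0 hx1] at hx
    have h1 := congrArg Real.log hx
    rw [Real.log_mul hn0.ne' (Real.exp_pos _).ne', Real.log_exp, Real.log_one] at h1
    have h2 : Real.log n / ρ = (-Real.log x) ^ α := by
      rw [div_eq_iff hρ.ne']; linarith
    rw [h2, one_div, Real.rpow_rpow_inv hL.le hα.ne', neg_neg, Real.exp_log hx0]
  · rintro rfl
    have hp : 0 < (Real.log n / ρ) ^ (1 / α) := Real.rpow_pos_of_pos hq _
    refine ⟨Real.exp_pos _, ?_⟩
    rw [cdf_edgeLaw_of_lt_one hρ hα (Real.exp_pos _) (Real.exp_lt_one_iff.2 (by linarith)),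
      Real.log_exp, neg_neg, one_div, Real.rpow_inv_rpow hq.le hα.ne', neg_mul,
      mul_div_cancel₀ _ hρ.ne', Real.exp_neg, Real.exp_log hn0, mul_inv_cancel₀ hn0.ne']

theorem charScale_edgeLaw {ρ α : ℝ} (hρ : 0 < ρ) (hα : 0 < α) {n : ℕ} (hn : 2 ≤ n) :
    charScale (edgeLaw ρ α) n = Real.exp (-(Real.log n / ρ) ^ (1 / α)) := by
  have : {x : ℝ | 0 < x ∧ (n : ℝ) * cdf (edgeLaw ρ α) x = 1} =
      {Real.exp (-(Real.log n / ρ) ^ (1 / α))} := by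
    ext x
    exact charScale_unique hρ hα hn x
  rw [charScale, this, csInf_singleton]

/-! Put M = (log n / ρ)^(1/α), so that n = exp(ρ M^α), u_n = e^(-M) and s_n log n = M/α. With η =
min(ε_n, 1), call an edge open if its weight is at most (1+η) e u_n. An open path with K = ⌈M/α⌉
edges is light enough, so it suffices to find one with high probability. Only paths that cross k =
K-1 disjoint layers of m ≈ n/k vertices are counted.

If p is the probability that an edge is open, the mean number of open layered paths is m^k p^K =
(mp)^K / m. With l = 1 + log(1+η), log(mp) is about α l ρ M^(α-1), so the logarithm of the mean is
about ρ M^α (l-1). Thus e is the critical factor, and the gain from η beats the errors because η M →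
∞ (`mul_log_mean_degree_bound`).

Layering lets the overlap of two paths be followed one layer at a time. This yields a recursion, and
`pairSum_bound` concludes that the second moment is at most 1 + m/(mp)^K + 10/(mp) times the squared
mean. `second_moment_bound` then produces an open path (`prob_layered_path`). -/

/-- The second moment method for a finite family of events. -/
theorem second_moment_bound {Ω ι : Type*} [MeasurableSpace Ω] (P : Measure Ω)
    [IsProbabilityMeasure P] (s : Finset ι) (A : ι → Set Ω)
    (hA : ∀ i ∈ s, NullMeasurableSet (A i) P) :
    (1 - P.real (⋃ i ∈ s, A i)) * (∑ i ∈ s, P.real (A i)) ^ 2 ≤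
      ∑ i ∈ s, ∑ j ∈ s, P.real (A i ∩ A j) - (∑ i ∈ s, P.real (A i)) ^ 2 := by
  classical
  set E := ∑ i ∈ s, P.real (A i) with hE
  have key : ∀ B : Set Ω, NullMeasurableSet B P →
      Integrable (B.indicator (1 : Ω → ℝ)) P ∧ ∫ ω, B.indicator (1 : Ω → ℝ) ω ∂P = P.real B := by
    intro B hB
    refine ⟨(integrable_const (1 : ℝ)).indicator₀ hB, ?_⟩
    rw [integral_indicator₀ hB]
    simp
  have hU : NullMeasurableSet (⋃ i ∈ s, A i)ᶜ P :=
    (NullMeasurableSet.biUnion s.countable_toSet hA).compl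
  have hAA : ∀ i ∈ s, ∀ j ∈ s, NullMeasurableSet (A i ∩ A j) P :=
    fun i hi j hj => (hA i hi).inter (hA j hj)
  have hi2 : Integrable (fun ω => ∑ i ∈ s, ∑ j ∈ s, (A i ∩ A j).indicator (1 : Ω → ℝ) ω) P :=
    integrable_finsetSum _ fun i hi => integrable_finsetSum _ fun j hj =>
      (key _ (hAA i hi j hj)).1
  have hi1 : Integrable (fun ω => 2 * E * ∑ i ∈ s, (A i).indicator (1 : Ω → ℝ) ω) P :=
    (integrable_finsetSum _ fun i hi => (key _ (hA i hi)).1).const_mul _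
  have hI : ∫ ω, (∑ i ∈ s, ∑ j ∈ s, (A i ∩ A j).indicator (1 : Ω → ℝ) ω
      - 2 * E * ∑ i ∈ s, (A i).indicator (1 : Ω → ℝ) ω + E ^ 2) ∂P =
      ∑ i ∈ s, ∑ j ∈ s, P.real (A i ∩ A j) - E ^ 2 := by
    rw [integral_add (f := fun ω => _ - _) (hi2.sub hi1) (integrable_const _),
      integral_sub hi2 hi1,
      integral_const_mul, integral_finsetSum _ (fun i hi => (key _ (hA i hi)).1),
      integral_finsetSum _ (fun i hi => integrable_finsetSum _ fun j hj =>
        (key _ (hAA i hi j hj)).1)]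
    rw [Finset.sum_congr rfl (fun i hi => (key _ (hA i hi)).2), ← hE,
      Finset.sum_congr rfl (fun i hi => by
        rw [integral_finsetSum _ (fun j hj => (key _ (hAA i hi j hj)).1),
          Finset.sum_congr rfl (fun j hj => (key _ (hAA i hi j hj)).2)])]
    simp
    ring
  have hC : ∫ ω, E ^ 2 * (⋃ i ∈ s, A i)ᶜ.indicator (1 : Ω → ℝ) ω ∂P =
      (1 - P.real (⋃ i ∈ s, A i)) * E ^ 2 := by
    have h2 : P.real (⋃ i ∈ s, A i)ᶜ = 1 - P.real (⋃ i ∈ s, A i) := by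
      have := probReal_compl_eq_one_sub₀ (NullMeasurableSet.biUnion s.countable_toSet hA)
      exact this
    rw [integral_const_mul, (key _ hU).2, h2, mul_comm]
  rw [← hI, ← hC]
  -- With N the number of events that occur, the right integrand is (N - E)². It equals E² where N =
  -- 0 and is nonnegative elsewhere.
  refine integral_mono ((key _ hU).1.const_mul _)
    ((hi2.sub hi1).add (integrable_const _)) fun ω => ?_
  have hsq : ∑ i ∈ s, ∑ j ∈ s, (A i ∩ A j).indicator (1 : Ω → ℝ) ω =
      (∑ i ∈ s, (A i).indicator (1 : Ω → ℝ) ω) ^ 2 := by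
    rw [sq, Finset.sum_mul_sum]
    simp only [Set.inter_indicator_one, Pi.mul_apply]
  dsimp only
  rw [hsq]
  by_cases h : ω ∈ (⋃ i ∈ s, A i)ᶜ
  · have h0 : ∑ i ∈ s, (A i).indicator (1 : Ω → ℝ) ω = 0 := by
      refine Finset.sum_eq_zero fun i hi => Set.indicator_of_notMem (fun hω => h ?_) _
      exact Set.mem_biUnion hi hω
    rw [h0, Set.indicator_of_mem h]
    simp
  · rw [Set.indicator_of_notMem h]
    nlinarith [sq_nonneg (∑ i ∈ s, (A i).indicator (1 : Ω → ℝ) ω - E)]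

/-! ### Layered paths and the overlaps of their edge sets. -/

section Layered

variable {V : Type*} [DecidableEq V] {m : ℕ}

/-- The edges of the path from `a` to `b` that visits the vertex `φ i (v (t - 1 - i))` of each
layer `i < t`, in decreasing order of the layers. -/
def layeredEdges (φ : ℕ → Fin m → V) (b : V) : (t : ℕ) → V → (Fin t → Fin m) → Finset (Sym2 V)
  | 0, a, _ => {s(a, b)}
  | t + 1, a, v => insert s(a, φ t (v 0)) (layeredEdges φ b t (φ t (v 0)) (Fin.tail v))

variable {φ : ℕ → Fin m → V} {b : V} {r : V → ℕ} {k : ℕ}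

/-- The rank `r` drops by exactly one along each edge of a layered path. This makes all edges
distinct and the path self-avoiding. -/
theorem rank_le_of_mem_layeredEdges (hb : r b = 0) (hφ : ∀ t < k, ∀ j, r (φ t j) = t + 1)
    {t : ℕ} (ht : t ≤ k) {a : V} (ha : r a = t + 1) (v : Fin t → Fin m) {e : Sym2 V}
    (he : e ∈ layeredEdges φ b t a v) : ∀ x ∈ e, r x ≤ t + 1 := by
  induction t generalizing a with
  | zero =>
    rw [layeredEdges, Finset.mem_singleton] at he
    subst he
    simp [hb, ha]
  | succ t ih =>
    rw [layeredEdges, Finset.mem_insert] at he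
    rcases he with rfl | he
    · simp [ha, hφ t (by omega)]
    · intro x hx
      exact (ih (by omega) (hφ t (by omega) _) _ he x hx).trans (by omega)

theorem not_isDiag_of_mem_layeredEdges (hb : r b = 0)
    (hφ : ∀ t < k, ∀ j, r (φ t j) = t + 1)
    {t : ℕ} (ht : t ≤ k) {a : V} (ha : r a = t + 1) (v : Fin t → Fin m) {e : Sym2 V}
    (he : e ∈ layeredEdges φ b t a v) : ¬ e.IsDiag := by
  induction t generalizing a with
  | zero =>
    rw [layeredEdges, Finset.mem_singleton] at he
    subst he
    rw [Sym2.mk_isDiag_iff]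
    rintro rfl
    omega
  | succ t ih =>
    rw [layeredEdges, Finset.mem_insert] at he
    rcases he with rfl | he
    · rw [Sym2.mk_isDiag_iff]
      intro h
      have := hφ t (by omega) (v 0)
      rw [← h] at this
      omega
    · exact ih (by omega) (hφ t (by omega) _) _ he

theorem top_notMem_layeredEdges (hb : r b = 0) (hφ : ∀ t < k, ∀ j, r (φ t j) = t + 1)
    {t : ℕ} (ht : t ≤ k) {a : V} (ha : r a = t + 1) (v : Fin t → Fin m) {x y : V}
    (hx : r x = t + 2) : s(x, y) ∉ layeredEdges φ b t a v := fun h => by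
  have := rank_le_of_mem_layeredEdges hb hφ ht ha v h x (Sym2.mem_mk_left _ _)
  omega

theorem card_layeredEdges (hb : r b = 0) (hφ : ∀ t < k, ∀ j, r (φ t j) = t + 1)
    {t : ℕ} (ht : t ≤ k) {a : V} (ha : r a = t + 1) (v : Fin t → Fin m) :
    (layeredEdges φ b t a v).card = t + 1 := by
  induction t generalizing a with
  | zero => simp [layeredEdges]
  | succ t ih =>
    have h := hφ t (by omega) (v 0)
    rw [layeredEdges, Finset.card_insert_of_notMem
      (top_notMem_layeredEdges hb hφ (by omega) h _ ha), ih (by omega) h]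

/-- By rank, the two top edges lie in neither remaining path, so they add one edge if they coincide
and two otherwise. -/
theorem card_layeredEdges_union_succ (hb : r b = 0) (hφ : ∀ t < k, ∀ j, r (φ t j) = t + 1)
    (hinj : ∀ t < k, Function.Injective (φ t))
    {t : ℕ} (ht : t < k) {a a' : V} (ha : r a = t + 2) (ha' : r a' = t + 2)
    (v v' : Fin (t + 1) → Fin m) :
    (layeredEdges φ b (t + 1) a v ∪ layeredEdges φ b (t + 1) a' v').card =
      (if a = a' ∧ v 0 = v' 0 then 1 else 2) +
      (layeredEdges φ b t (φ t (v 0)) (Fin.tail v) ∪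
        layeredEdges φ b t (φ t (v' 0)) (Fin.tail v')).card := by
  have h := hφ t ht (v 0)
  have h' := hφ t ht (v' 0)
  have n1 : ∀ {x y}, r x = t + 2 → s(x, y) ∉ layeredEdges φ b t (φ t (v 0)) (Fin.tail v) ∪
        layeredEdges φ b t (φ t (v' 0)) (Fin.tail v') := by
    intro x y hx
    rw [Finset.mem_union, not_or]
    exact ⟨top_notMem_layeredEdges hb hφ ht.le h _ hx, top_notMem_layeredEdges hb hφ ht.le h' _ hx⟩
  rw [layeredEdges, layeredEdges, Finset.insert_union, Finset.union_insert]
  split_ifs with hc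
  · rw [← hc.1, ← hc.2, Finset.insert_idem, Finset.card_insert_of_notMem, add_comm]
    have := @n1 a (φ t (v 0)) ha
    rwa [← hc.2] at this
  · rw [Finset.card_insert_of_notMem, Finset.card_insert_of_notMem (n1 ha')]
    · ring
    · rw [Finset.mem_insert, not_or]
      refine ⟨fun h2 => ?_, n1 ha⟩
      rw [Sym2.eq_iff] at h2
      rcases h2 with ⟨h3, h4⟩ | ⟨h3, h4⟩
      · exact hc ⟨h3, hinj t ht h4⟩
      -- A match with endpoints swapped would give `a` the rank of the layer below.
      · rw [h3] at ha
        omega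

theorem card_layeredEdges_union_zero (a a' : V) (v v' : Fin 0 → Fin m) :
    (layeredEdges φ b 0 a v ∪ layeredEdges φ b 0 a' v').card = if a = a' then 1 else 2 := by
  rw [layeredEdges, layeredEdges]
  split_ifs with h
  · simp [h]
  · rw [Finset.card_union_of_disjoint (by simpa [Sym2.eq_iff] using ⟨h, fun h1 h2 => h (h1.trans h2)⟩)]
    simp

/-! ### The second moment recursion. -/

/-- The sum over pairs of layered paths of the probability that both are open. -/
noncomputable def pairSum (φ : ℕ → Fin m → V) (b : V) (p : ℝ) (t : ℕ) (a a' : V) : ℝ :=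
  ∑ v : Fin t → Fin m, ∑ v' : Fin t → Fin m,
    p ^ (layeredEdges φ b t a v ∪ layeredEdges φ b t a' v').card

theorem sum_fin_succ_fun {M : Type*} [AddCommMonoid M] {t : ℕ} (f : (Fin (t + 1) → Fin m) → M) :
    ∑ v, f v = ∑ x : Fin m, ∑ w : Fin t → Fin m, f (Fin.cons x w) := by
  rw [← Fintype.sum_prod_type']
  exact (Fintype.sum_equiv (Fin.consEquiv fun _ => Fin m) _ _ fun _ => rfl).symm

theorem pairSum_succ (hb : r b = 0) (hφ : ∀ t < k, ∀ j, r (φ t j) = t + 1)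
    (hinj : ∀ t < k, Function.Injective (φ t)) (p : ℝ)
    {t : ℕ} (ht : t < k) {a a' : V} (ha : r a = t + 2) (ha' : r a' = t + 2) :
    pairSum φ b p (t + 1) a a' = ∑ x : Fin m, ∑ x' : Fin m,
      (if a = a' ∧ x = x' then p else p ^ 2) * pairSum φ b p t (φ t x) (φ t x') := by
  unfold pairSum
  rw [sum_fin_succ_fun]
  refine Finset.sum_congr rfl fun x _ => ?_
  simp_rw [sum_fin_succ_fun (fun v' : Fin (t + 1) → Fin m => _)]
  rw [Finset.sum_comm]
  refine Finset.sum_congr rfl fun x' _ => ?_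
  rw [Finset.mul_sum]
  refine Finset.sum_congr rfl fun w _ => ?_
  rw [Finset.mul_sum]
  refine Finset.sum_congr rfl fun w' _ => ?_
  rw [card_layeredEdges_union_succ hb hφ hinj ht ha ha', pow_add]
  simp only [Fin.cons_zero, Fin.tail_cons]
  congr 1
  split_ifs <;> simp

/-- The sum depends on the start vertices only through whether they agree. Relative to the squared
mean, let 1+x and 1+y be the bounds for equal and distinct starts, and let μ = mp. One more layer
replaces x by at most (1+x)/μ + y and y by at most y + x/m; the stated expressions are stable under
this map. -/
theorem pairSum_bound (hb : r b = 0) (hφ : ∀ t < k, ∀ j, r (φ t j) = t + 1)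
    (hinj : ∀ t < k, Function.Injective (φ t)) {p : ℝ} (hp : 0 < p)
    (hμ : 2 ≤ m * p) (hm : 5 * k ≤ m) (hm0 : 0 < m)
    {t : ℕ} (ht : t ≤ k) {a a' : V} (ha : r a = t + 1) (ha' : r a' = t + 1) :
    pairSum φ b p t a a' ≤ (m ^ t * p ^ (t + 1)) ^ 2 * (1 + if a = a' then
      m / (m * p) ^ (t + 1) + 10 / (m * p) else
      2 / (m * p) * (1 - (1 / 2) ^ t) + 10 * t / (m * (m * p))) := by
  have hmR : (0 : ℝ) < m := by exact_mod_cast hm0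
  have hm1 : (1 : ℝ) ≤ m := by exact_mod_cast hm0
  induction t generalizing a a' with
  | zero =>
    simp only [pairSum, card_layeredEdges_union_zero]
    split_ifs with h
    · simp
      have : p ^ 2 * (1 + (m / (m * p) + 10 / (m * p))) = p + p ^ 2 + 10 * p / m := by
        field_simp
        ring
      rw [this]
      have : 0 ≤ 10 * p / m := by positivity
      nlinarith [sq_nonneg p]
    · simp
  | succ t ih =>
    have ht' : t < k := ht
    set μ := (m : ℝ) * p with hμd
    have hμ0 : 0 < μ := by positivity
    set x := m / μ ^ (t + 1) + 10 / μ with hx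
    set y := 2 / μ * (1 - (1 / 2) ^ t) + 10 * t / (m * μ) with hy
    set c := (m ^ t * p ^ (t + 1)) ^ 2 with hc
    have hc0 : 0 < c := by positivity
    have h1 : ∀ z z' : Fin m, pairSum φ b p t (φ t z) (φ t z') ≤
        c * (1 + if z = z' then x else y) := by
      intro z z'
      have := ih ht'.le (hφ t ht' z) (hφ t ht' z')
      simpa only [(hinj t ht').eq_iff] using this
    have hx0 : 0 ≤ x := by positivity
    have hpow : (1 / 2 : ℝ) ^ t ≤ 1 := pow_le_one₀ (by norm_num) (by norm_num)
    have hy0 : 0 ≤ y := by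
      have : 0 ≤ 1 - (1 / 2 : ℝ) ^ t := by linarith
      positivity
    have hsum : ∀ (q : ℝ), 0 ≤ q →
        ∑ z : Fin m, ∑ z' : Fin m, (if z = z' then q * (c * (1 + x)) else
          p ^ 2 * (c * (1 + y))) ≤
        m * (q * (c * (1 + x))) + m ^ 2 * (p ^ 2 * (c * (1 + y))) := by
      intro q hq
      have : ∀ z : Fin m, ∑ z' : Fin m, (if z = z' then q * (c * (1 + x)) else
          p ^ 2 * (c * (1 + y))) ≤ q * (c * (1 + x)) + m * (p ^ 2 * (c * (1 + y))) := by
        intro z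
        calc _ ≤ ∑ z' : Fin m, ((if z = z' then q * (c * (1 + x)) else 0) +
              p ^ 2 * (c * (1 + y))) := by
              refine Finset.sum_le_sum fun z' _ => ?_
              split_ifs
              · have : 0 ≤ p ^ 2 * (c * (1 + y)) := by positivity
                linarith
              · simp
          _ = _ := by rw [Finset.sum_add_distrib]; simp
      calc _ ≤ ∑ z : Fin m, (q * (c * (1 + x)) + m * (p ^ 2 * (c * (1 + y)))) :=
            Finset.sum_le_sum fun z _ => this z
        _ = _ := by simp; ring
    have hC : (m ^ (t + 1) * p ^ (t + 1 + 1)) ^ 2 = c * μ ^ 2 := by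
      rw [hc, hμd]; ring
    -- The right side is exactly the increment of y from t to t + 1; μ ≥ 2 makes these increments
    -- summable.
    have hxm : x / m ≤ 1 / μ * (1 / 2) ^ t + 10 / (m * μ) := by
      have e : x / m = 1 / μ * (1 / μ) ^ t + 10 / (m * μ) := by
        rw [hx, one_div_pow, pow_succ]; field_simp
      rw [e]
      have : (1 / μ) ^ t ≤ (1 / 2 : ℝ) ^ t := by gcongr
      gcongr
    rw [pairSum_succ hb hφ hinj p ht' ha ha', hC]
    split_ifs with h
    · have hbd : ∑ z : Fin m, ∑ z' : Fin m, (if a = a' ∧ z = z' then p else p ^ 2) *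
          pairSum φ b p t (φ t z) (φ t z') ≤
          m * (p * (c * (1 + x))) + m ^ 2 * (p ^ 2 * (c * (1 + y))) := by
        refine le_trans (Finset.sum_le_sum fun z _ => Finset.sum_le_sum fun z' _ => ?_)
          (hsum p hp.le)
        have := h1 z z'
        by_cases hz : z = z'
        · simp only [h, hz, if_true, and_self] at this ⊢
          gcongr
        · simp only [hz, if_false, and_false] at this ⊢
          gcongr
      refine hbd.trans ?_
      have e : m * (p * (c * (1 + x))) + m ^ 2 * (p ^ 2 * (c * (1 + y))) =
          c * μ ^ 2 * ((1 + x) / μ + (1 + y)) := by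
        rw [hμd]; field_simp
      rw [e]
      have hy4 : y ≤ 4 / μ := by
        have h5 : 10 * (t : ℝ) / (m * μ) ≤ 2 / μ := by
          rw [div_le_div_iff₀ (by positivity) hμ0]
          have : (5 : ℝ) * t ≤ m := by exact_mod_cast (by omega : 5 * t ≤ m)
          nlinarith
        have h6 : 2 / μ * (1 - (1 / 2 : ℝ) ^ t) ≤ 2 / μ := by
          have : (0 : ℝ) ≤ (1 / 2) ^ t := by positivity
          have h7 : 0 ≤ 2 / μ := by positivity
          nlinarith
        have : 4 / μ = 2 / μ + 2 / μ := by ring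
        linarith
      have hxμ : x / μ ≤ m / μ ^ (t + 1 + 1) + 5 / μ := by
        have e : x / μ = m / μ ^ (t + 1 + 1) + 10 / μ / μ := by
          rw [hx, pow_succ _ (t + 1)]; field_simp
        rw [e]
        have : 10 / μ / μ ≤ 5 / μ := by
          rw [div_div, div_le_div_iff₀ (by positivity) hμ0]
          nlinarith
        gcongr
      refine mul_le_mul_of_nonneg_left ?_ (by positivity)
      -- The constant 10 reproduces itself as 1 + 4 + 5: the first summand of (1+x)/μ, the bound on
      -- y from 5t ≤ m, and 10/μ² ≤ 5/μ.
      have e1 : (1 + x) / μ = 1 / μ + x / μ := by ring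
      have e2 : 10 / μ = 1 / μ + 4 / μ + 5 / μ := by ring
      rw [e1, e2]
      linarith
    · have hbd : ∑ z : Fin m, ∑ z' : Fin m, (if a = a' ∧ z = z' then p else p ^ 2) *
          pairSum φ b p t (φ t z) (φ t z') ≤
          m * (p ^ 2 * (c * (x - y))) + m ^ 2 * (p ^ 2 * (c * (1 + y))) := by
        calc _ ≤ ∑ z : Fin m, ∑ z' : Fin m, ((if z = z' then p ^ 2 * (c * (x - y)) else 0) +
              p ^ 2 * (c * (1 + y))) := by
              refine Finset.sum_le_sum fun z _ => Finset.sum_le_sum fun z' _ => ?_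
              have := h1 z z'
              simp only [h, false_and, if_false]
              refine (mul_le_mul_of_nonneg_left this (by positivity)).trans (le_of_eq ?_)
              split_ifs <;> ring
          _ = _ := by simp_rw [Finset.sum_add_distrib]; simp; ring
      refine hbd.trans ?_
      have e : m * (p ^ 2 * (c * (x - y))) + m ^ 2 * (p ^ 2 * (c * (1 + y))) =
          c * μ ^ 2 * (x / m - y / m + (1 + y)) := by
        rw [hμd]; field_simp
      rw [e]
      refine mul_le_mul_of_nonneg_left ?_ (by positivity)
      have : 0 ≤ y / m := by positivity
      have e1 : 2 / μ * (1 - (1 / 2 : ℝ) ^ (t + 1)) + 10 * ((t + 1 : ℕ) : ℝ) / (m * μ) =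
          y + (1 / μ * (1 / 2) ^ t + 10 / (m * μ)) := by
        rw [hy]; push_cast; ring
      rw [e1]
      linarith

/-! ### From open layered paths to the minimal path weight. -/

theorem exists_path_of_layeredEdges (hb : r b = 0) (hφ : ∀ t < k, ∀ j, r (φ t j) = t + 1)
    (x : Sym2 V → ℝ) (c : ℝ) {t : ℕ} (ht : t ≤ k) {a : V} (ha : r a = t + 1)
    (v : Fin t → Fin m) (hv : ∀ e ∈ layeredEdges φ b t a v, x e ≤ c) :
    ∃ w : (⊤ : SimpleGraph V).Walk a b, w.IsPath ∧ (∀ z ∈ w.support, r z ≤ t + 1) ∧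
      pathWeight x w ≤ (t + 1) * c := by
  induction t generalizing a with
  | zero =>
    have hab : (⊤ : SimpleGraph V).Adj a b := by
      rw [SimpleGraph.top_adj]; rintro rfl; omega
    refine ⟨.cons hab .nil, ?_, ?_, ?_⟩
    · simpa using hab.ne
    · simp [ha, hb]
    · simpa [pathWeight] using hv _ (by simp [layeredEdges])
  | succ t ih =>
    have h := hφ t (by omega) (v 0)
    obtain ⟨w, hw, hs, hwt⟩ := ih (by omega) h (Fin.tail v)
      (fun e he => hv e (by rw [layeredEdges]; exact Finset.mem_insert_of_mem he))
    have hab : (⊤ : SimpleGraph V).Adj a (φ t (v 0)) := by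
      rw [SimpleGraph.top_adj]; rintro h2; rw [← h2] at h; omega
    refine ⟨.cons hab w, ?_, ?_, ?_⟩
    · rw [SimpleGraph.Walk.cons_isPath_iff]
      refine ⟨hw, fun h3 => ?_⟩
      have := hs _ h3
      omega
    · intro z hz
      rw [SimpleGraph.Walk.support_cons, List.mem_cons] at hz
      rcases hz with rfl | hz
      · omega
      · exact (hs z hz).trans (by omega)
    · have h1 := hv s(a, φ t (v 0)) (by rw [layeredEdges]; exact Finset.mem_insert_self _ _)
      simp only [pathWeight, SimpleGraph.Walk.edges_cons, List.map_cons, List.sum_cons] at hwt ⊢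
      push_cast
      linarith

/-- If the edges of the complete graph are independently open with probability `p`, then some
layered path from `a` to `b` is open with high probability. -/
theorem prob_layered_path [Fintype V] {Ω : Type*} [MeasurableSpace Ω] (P : Measure Ω)
    [IsProbabilityMeasure P] (X : Sym2 V → Ω → ℝ) (ν : Measure ℝ) [IsProbabilityMeasure ν]
    (hlaw : ∀ e ∈ (⊤ : SimpleGraph V).edgeSet, HasLaw (X e) ν P)
    (hindep : iIndepFun (fun e : (⊤ : SimpleGraph V).edgeSet => X (e : Sym2 V)) P)
    (c : ℝ) (hb : r b = 0) (hφ : ∀ t < k, ∀ j, r (φ t j) = t + 1)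
    (hinj : ∀ t < k, Function.Injective (φ t)) (hp : 0 < cdf ν c)
    (hμ : 2 ≤ m * cdf ν c) (hm : 5 * k ≤ m) (hm0 : 0 < m) {a : V} (ha : r a = k + 1) :
    1 - (m / (m * cdf ν c) ^ (k + 1) + 10 / (m * cdf ν c)) ≤
      P.real {ω | minPathWeight (⊤ : SimpleGraph V) (fun e => X e ω) a b ≤ (k + 1) * c} := by
  classical
  set p := cdf ν c with hpd
  set A : (Fin k → Fin m) → Set Ω := fun v => ⋂ e ∈ layeredEdges φ b k a v, X e ⁻¹' Set.Iic c
    with hAd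
  have hmR : (0 : ℝ) < m := by exact_mod_cast hm0
  have hedge : ∀ v, ∀ e ∈ layeredEdges φ b k a v, e ∈ (⊤ : SimpleGraph V).edgeSet := by
    intro v e he
    rw [SimpleGraph.edgeSet_top]
    exact not_isDiag_of_mem_layeredEdges hb hφ le_rfl ha v he
  have hprob : ∀ S : Finset (Sym2 V), (∀ e ∈ S, e ∈ (⊤ : SimpleGraph V).edgeSet) →
      P.real (⋂ e ∈ S, X e ⁻¹' Set.Iic c) = p ^ S.card := by
    intro S hS
    have h1 := hindep.measure_inter_preimage_eq_mul
      (S.subtype (· ∈ (⊤ : SimpleGraph V).edgeSet)) (sets := fun _ => Set.Iic c)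
      (fun _ _ => measurableSet_Iic)
    have h2 : (⋂ e ∈ S, X e ⁻¹' Set.Iic c) = ⋂ e ∈ S.subtype (· ∈ (⊤ : SimpleGraph V).edgeSet),
        X (e : Sym2 V) ⁻¹' Set.Iic c := by
      ext ω
      simp only [Set.mem_iInter, Finset.mem_subtype, Subtype.forall]
      exact ⟨fun h e _ he => h e he, fun h e he => h e (hS e he) he⟩
    have h3 : ∀ e ∈ S.subtype (· ∈ (⊤ : SimpleGraph V).edgeSet),
        P (X (e : Sym2 V) ⁻¹' Set.Iic c) = ENNReal.ofReal p := by
      intro e _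
      have hl := hlaw e e.2
      rw [← Measure.map_apply_of_aemeasurable hl.aemeasurable measurableSet_Iic, hl.map_eq, hpd,
        ofReal_cdf]
    rw [h2, measureReal_def, h1, Finset.prod_congr rfl h3, Finset.prod_const, ENNReal.toReal_pow,
      ENNReal.toReal_ofReal hp.le, Finset.card_subtype, Finset.filter_true_of_mem hS]
  have hnull : ∀ v ∈ Finset.univ, NullMeasurableSet (A v) P := by
    intro v _
    refine NullMeasurableSet.biInter (layeredEdges φ b k a v).countable_toSet fun e he => ?_
    exact (hlaw e (hedge v e he)).aemeasurable.nullMeasurable measurableSet_Iic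
  have hA1 : ∀ v, P.real (A v) = p ^ (k + 1) := by
    intro v
    rw [hAd]
    dsimp only
    rw [hprob _ (hedge v), card_layeredEdges hb hφ le_rfl ha]
  have hA2 : ∀ v v', P.real (A v ∩ A v') =
      p ^ (layeredEdges φ b k a v ∪ layeredEdges φ b k a v').card := by
    intro v v'
    rw [← hprob]
    · congr 1
      ext ω
      simp only [hAd, Set.mem_inter_iff, Set.mem_iInter, Finset.mem_union, or_imp, forall_and]
    · intro e he
      rcases Finset.mem_union.1 he with he | he
      · exact hedge v e he
      · exact hedge v' e he
  have hsm := second_moment_bound P Finset.univ A hnull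
  have hb2 := pairSum_bound (a := a) (a' := a) hb hφ hinj hp hμ hm hm0 le_rfl ha ha
  rw [pairSum] at hb2
  simp only [hA1, hA2, Finset.sum_const, Finset.card_univ, Fintype.card_fun, Fintype.card_fin,
    nsmul_eq_mul, Nat.cast_pow] at hsm
  rw [if_pos rfl] at hb2
  have hpos : 0 < ((m : ℝ) ^ k * p ^ (k + 1)) ^ 2 := by positivity
  -- Divide the second moment inequality by the squared mean.
  have hmain : 1 - P.real (⋃ i ∈ Finset.univ, A i) ≤
      m / (m * p) ^ (k + 1) + 10 / (m * p) := by
    nlinarith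
  have hsub : (⋃ i ∈ Finset.univ, A i) ⊆
      {ω | minPathWeight (⊤ : SimpleGraph V) (fun e => X e ω) a b ≤ (k + 1) * c} := by
    intro ω hω
    simp only [Finset.mem_univ, Set.iUnion_true, Set.mem_iUnion] at hω
    obtain ⟨v, hv⟩ := hω
    simp only [hAd, Set.mem_iInter, Set.mem_preimage, Set.mem_Iic] at hv
    obtain ⟨w, hw, -, hwt⟩ := exists_path_of_layeredEdges hb hφ (fun e => X e ω) c le_rfl ha v hv
    have hfin : Finite ((⊤ : SimpleGraph V).Path a b) := inferInstance
    exact (ciInf_le (Set.finite_range fun q : (⊤ : SimpleGraph V).Path a b =>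
      pathWeight (fun e => X e ω) (q : (⊤ : SimpleGraph V).Walk a b)).bddBelow ⟨w, hw⟩).trans hwt
  have := measureReal_mono hsub (μ := P)
  linarith

end Layered

/-! ### Size of the mean number of open paths. -/

/-- Lower bound for the logarithm of the expected number of open layered paths. -/
theorem mul_log_mean_degree_bound {ρ α M η K m : ℝ} (hρ : 0 < ρ) (hα : 2 < α) (hη0 : 0 ≤ η)
    (hη1 : η ≤ 1) (hM : 2 * α ≤ M) (hK : M / α ≤ K) (hKM : K ≤ M)
    (hm : Real.exp (ρ * M ^ α) / (2 * K) ≤ m) :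
    ρ * M ^ (α - 1) * (η * M / 2 - 4 * α) - M * Real.log (2 * M) ≤
      K * Real.log (m * Real.exp (-ρ * (M - (1 + Real.log (1 + η))) ^ α)) - ρ * M ^ α := by
  have hα0 : 0 < α := by linarith
  have hM0 : 0 < M := by linarith
  have hK0 : 0 < K := (div_pos hM0 hα0).trans_le hK
  set T := ρ * M ^ (α - 1) with hT
  have hT0 : 0 < T := by positivity
  have hTM : ρ * M ^ α = T * M := by
    rw [hT, mul_assoc, ← Real.rpow_add_one hM0.ne']
    ring_nf
  have hl1 : η / 2 ≤ Real.log (1 + η) := by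
    refine le_trans ?_ (Real.one_sub_inv_le_log_of_pos (by linarith))
    rw [show 1 - (1 + η)⁻¹ = η / (1 + η) by field_simp; ring]
    gcongr
    linarith
  have hl2 : Real.log (1 + η) ≤ 1 := by
    have := Real.log_le_sub_one_of_pos (show 0 < 1 + η by linarith)
    linarith
  set l := 1 + Real.log (1 + η) with hl
  have hl0 : 0 ≤ l := by linarith
  have hlM : α * (l / M) ≤ 1 := by
    rw [← mul_div_assoc, div_le_one hM0]
    nlinarith
  have hz0 : 0 ≤ l / M := by positivity
  have hx1 : 0 < 1 - l / M := by nlinarith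
  -- Combine (1 - l/M)^α ≤ exp(-αl/M) with exp(-z) ≤ 1 - z + z² for 0 ≤ z ≤ 1.
  have hpow : (M - l) ^ α ≤ M ^ α * (1 - α * (l / M) + (α * (l / M)) ^ 2) := by
    have e1 : M - l = M * (1 - l / M) := by field_simp
    rw [e1, Real.mul_rpow hM0.le hx1.le]
    gcongr
    rw [Real.rpow_def_of_pos hx1]
    have h1 : Real.log (1 - l / M) * α ≤ -(α * (l / M)) := by
      have := Real.log_le_sub_one_of_pos hx1
      nlinarith
    have h2 := Real.abs_exp_sub_one_sub_id_le (x := -(α * (l / M)))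
      (by rw [abs_neg, abs_of_nonneg (by positivity)]; exact hlM)
    have h3 := (abs_le.1 h2).2
    have h4 := Real.exp_le_exp.2 h1
    nlinarith
  have hm0 : 0 < m := lt_of_lt_of_le (by positivity) hm
  have hlogm : T * M - Real.log (2 * K) ≤ Real.log m := by
    have := Real.log_le_log (by positivity) hm
    rwa [Real.log_div (Real.exp_pos _).ne' (by positivity), Real.log_exp, hTM] at this
  rw [Real.log_mul hm0.ne' (Real.exp_pos _).ne', Real.log_exp, hTM]
  have hA : T * (α * l * (1 - α * (l / M))) - Real.log (2 * K) ≤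
      Real.log m + -ρ * (M - l) ^ α := by
    have h1 : ρ * (M - l) ^ α ≤ T * M * (1 - α * (l / M) + (α * (l / M)) ^ 2) := by
      rw [← hTM, mul_assoc]
      gcongr
    have h2 : T * M * (1 - α * (l / M) + (α * (l / M)) ^ 2) =
        T * M - T * (α * l * (1 - α * (l / M))) := by
      field_simp
      ring
    linarith
  have hB : M / α * (T * (α * l * (1 - α * (l / M)))) ≤
      K * (T * (α * l * (1 - α * (l / M)))) := by
    have : 0 ≤ 1 - α * (l / M) := by linarith
    gcongr
  have hB' : M / α * (T * (α * l * (1 - α * (l / M)))) = T * (M * l - α * l ^ 2) := by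
    field_simp
  have hK2 : 1 ≤ 2 * K := by
    have : 2 ≤ M / α := by rwa [le_div_iff₀ hα0]
    linarith
  have hC : K * Real.log (2 * K) ≤ M * Real.log (2 * M) := by
    have := Real.log_nonneg hK2
    gcongr
  -- Here M l - M = M log(1+η) ≥ η M / 2, and l ≤ 2 bounds the quadratic loss by 4α.
  have hD : η * M / 2 - 4 * α ≤ M * l - α * l ^ 2 - M := by
    have : l ^ 2 ≤ 4 := by nlinarith
    nlinarith
  have hE := mul_le_mul_of_nonneg_left hA hK0.le
  have hF := mul_le_mul_of_nonneg_left hD hT0.le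
  rw [mul_sub] at hE
  nlinarith

/-! ### Layers in the complete graph and the limit. -/

theorem optimalWeight_prob_bound {n : ℕ} {Ω : Type*} [MeasurableSpace Ω] (P : Measure Ω)
    [IsProbabilityMeasure P] {ρ α M η : ℝ} (hρ : 0 < ρ) (hα : 2 < α)
    (X : Sym2 (Fin n) → Ω → ℝ)
    (hlaw : ∀ e ∈ (⊤ : SimpleGraph (Fin n)).edgeSet, HasLaw (X e) (edgeLaw ρ α) P)
    (hindep : iIndepFun (fun e : (⊤ : SimpleGraph (Fin n)).edgeSet => X (e : Sym2 (Fin n))) P)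
    (hn : (n : ℝ) = Real.exp (ρ * M ^ α)) (hη0 : 0 ≤ η) (hη1 : η ≤ 1)
    (hM : 2 * α ≤ M) (hηM : 8 * α + 2 ≤ η * M) (hT1 : 1 ≤ ρ * M ^ (α - 1))
    (hlog : M * Real.log (2 * M) ≤ ρ * M ^ (α - 1))
    (hexp : 10 * M ^ 2 ≤ Real.exp (ρ * M ^ α)) :
    1 - (Real.exp (-(ρ * M ^ (α - 1) * (η * M / 2 - 4 * α - 1))) + 10 / (ρ * M ^ (α - 1))) ≤
      P.real {ω | optimalWeight n (fun e => X e ω) ≤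
        (⌈M / α⌉₊ : ℝ) * Real.exp (-(M - (1 + Real.log (1 + η))))} := by
  have hα0 : 0 < α := by linarith
  have hM0 : 0 < M := by linarith
  have hMα : 2 ≤ M / α := by rwa [le_div_iff₀ hα0]
  have := isProbabilityMeasure_edgeLaw ρ α
  obtain ⟨k, hk⟩ : ∃ k, ⌈M / α⌉₊ = k + 1 :=
    ⟨⌈M / α⌉₊ - 1, (Nat.sub_add_cancel (Nat.one_le_ceil_iff.2 (by linarith))).symm⟩
  have hK1 : M / α ≤ (k : ℝ) + 1 := by
    have := Nat.le_ceil (M / α)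
    rw [hk] at this
    exact_mod_cast this
  have hKM : (k : ℝ) + 1 ≤ M := by
    have h1 := Nat.ceil_lt_add_one (show 0 ≤ M / α by linarith)
    rw [hk] at h1
    push_cast at h1
    have h2 : M / α ≤ M / 2 := by gcongr
    linarith
  have hk0 : 0 < k := by
    have : (1 : ℝ) ≤ k := by linarith
    exact_mod_cast this
  have hn10 : 10 * (k + 1) ^ 2 ≤ n := by
    have : (10 : ℝ) * ((k : ℝ) + 1) ^ 2 ≤ n := by
      rw [hn]
      refine le_trans ?_ hexp
      gcongr
    exact_mod_cast this
  -- Two vertices are reserved as endpoints; the remainder of the division stays unused.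
  set m := (n - 2) / k with hm
  have hkm : 2 + k * m ≤ n := by
    have := Nat.mul_div_le (n - 2) k
    rw [← hm] at this
    have : 2 ≤ n := by nlinarith
    omega
  have h5 : 5 * k ≤ m := by
    rw [hm, Nat.le_div_iff_mul_le hk0]
    have : 5 * k * k + 2 ≤ n := by nlinarith
    omega
  have hm0 : 0 < m := by omega
  have hmn : (m : ℝ) ≤ n := by
    exact_mod_cast (Nat.div_le_self _ _).trans (Nat.sub_le _ _)
  have hm2 : Real.exp (ρ * M ^ α) / (2 * ((k : ℝ) + 1)) ≤ m := by
    rw [← hn, div_le_iff₀ (by positivity)]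
    have h1 : n < 2 + k * m + k := by
      have := Nat.lt_mul_div_succ (n - 2) hk0
      rw [← hm, mul_add] at this
      omega
    have h2 : n ≤ m * (2 * (k + 1)) := by nlinarith
    exact_mod_cast h2
  have hmain := mul_log_mean_degree_bound hρ hα hη0 hη1 hM hK1 hKM hm2
  set T := ρ * M ^ (α - 1) with hT
  have hT0 : 0 < T := by positivity
  have hTM : ρ * M ^ α = T * M := by
    rw [hT, mul_assoc, ← Real.rpow_add_one hM0.ne']
    ring_nf
  have hl2 : Real.log (1 + η) ≤ 1 := by
    have := Real.log_le_sub_one_of_pos (show 0 < 1 + η by linarith)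
    linarith
  set l := 1 + Real.log (1 + η) with hl
  set c := Real.exp (-(M - l)) with hc
  have hp : cdf (edgeLaw ρ α) c = Real.exp (-ρ * (M - l) ^ α) := by
    rw [cdf_edgeLaw_of_lt_one hρ hα0 (Real.exp_pos _) (Real.exp_lt_one_iff.2 (by linarith)),
      Real.log_exp, neg_neg]
  rw [← hp] at hmain
  have hp0 : 0 < cdf (edgeLaw ρ α) c := by rw [hp]; exact Real.exp_pos _
  set p := cdf (edgeLaw ρ α) c with hpd
  have hmR : (0 : ℝ) < m := by exact_mod_cast hm0
  have hμ0 : 0 < (m : ℝ) * p := by positivity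
  -- The extra -1 absorbs the term M log(2M) ≤ T; η M ≥ 8α + 2 is what makes D nonnegative.
  set D := T * (η * M / 2 - 4 * α - 1) with hD
  have hD0 : 0 ≤ D := mul_nonneg hT0.le (by linarith)
  have hDle : D ≤ ((k : ℝ) + 1) * Real.log (m * p) - T * M := by
    rw [← hTM]
    refine le_trans ?_ hmain
    rw [hD, mul_sub, mul_one]
    linarith
  -- The k + 1 ≤ M factors log(mp) total at least TM, so each is at least T.
  have hlogμ : T ≤ Real.log (m * p) := by
    have h1 : T * M ≤ ((k : ℝ) + 1) * Real.log (m * p) := by linarith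
    by_contra! h
    have h2 : ((k : ℝ) + 1) * Real.log (m * p) < ((k : ℝ) + 1) * T := by gcongr
    nlinarith
  have hexpT : Real.exp T ≤ m * p := by rwa [← Real.le_log_iff_exp_le hμ0]
  have hTμ : T + 1 ≤ m * p := (Real.add_one_le_exp T).trans hexpT
  have hn2 : 2 ≤ n := by omega
  have hT3 : (m : ℝ) / (m * p) ^ (k + 1) ≤ Real.exp (-D) := by
    have h1 : ((m : ℝ) * p) ^ (k + 1) = Real.exp (((k : ℝ) + 1) * Real.log (m * p)) := by
      rw [← Nat.cast_add_one, Real.exp_nat_mul, Real.exp_log hμ0]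
    calc (m : ℝ) / (m * p) ^ (k + 1) ≤ n / (m * p) ^ (k + 1) := by gcongr
      _ = Real.exp (T * M - ((k : ℝ) + 1) * Real.log (m * p)) := by
        rw [h1, hn, hTM, Real.exp_sub]
      _ ≤ Real.exp (-D) := Real.exp_le_exp.2 (by linarith)
  have hT4 : 10 / ((m : ℝ) * p) ≤ 10 / T := by
    gcongr
    linarith
  let a : Fin n := ⟨0, by omega⟩
  let b : Fin n := ⟨1, by omega⟩
  -- Layer t is the block of m labels from 2 + tm on; the value for t ≥ k is a dummy.
  let φ : ℕ → Fin m → Fin n := fun t j => if h : t < k then ⟨2 + t * m + j, by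
    have := j.2
    have : (t + 1) * m ≤ k * m := Nat.mul_le_mul_right _ h
    rw [add_mul] at this
    omega⟩ else a
  let r : Fin n → ℕ := fun v => if v.1 = 0 then k + 1 else if v.1 = 1 then 0 else (v.1 - 2) / m + 1
  have hφ : ∀ t < k, ∀ j, r (φ t j) = t + 1 := by
    intro t ht j
    have h1 : 2 + t * m + j.1 ≠ 0 := by omega
    have h2 : 2 + t * m + j.1 ≠ 1 := by omega
    simp only [r, φ, dif_pos ht, if_neg h1, if_neg h2]
    rw [show 2 + t * m + j.1 - 2 = j.1 + m * t by rw [mul_comm]; omega,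
      Nat.add_mul_div_left _ _ hm0, Nat.div_eq_of_lt j.2]
    omega
  have hinj : ∀ t < k, Function.Injective (φ t) := by
    intro t ht j j' h
    simp only [φ, dif_pos ht, Fin.mk.injEq] at h
    exact Fin.ext (by omega)
  have hfin := prob_layered_path (a := a) (b := b) P X (edgeLaw ρ α) hlaw hindep c
    (show r b = 0 by simp [r, b]) hφ hinj hp0 (by linarith) h5 hm0 (show r a = k + 1 by simp [r, a])
  have hset : {ω | optimalWeight n (fun e => X e ω) ≤ (⌈M / α⌉₊ : ℝ) * c} =
      {ω | minPathWeight (⊤ : SimpleGraph (Fin n)) (fun e => X e ω) a b ≤ (k + 1) * c} := by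
    rw [hk]
    simp [optimalWeight, dif_pos hn2, a, b]
  rw [hset]
  linarith

theorem theorem6p2 {Ω : ℕ → Type*} [∀ n, MeasurableSpace (Ω n)]
    (P : ∀ n, Measure (Ω n)) [∀ n, IsProbabilityMeasure (P n)]
    (ρ α : ℝ) (hρ : 0 < ρ) (hα : 2 < α)
    (X : ∀ n, Sym2 (Fin n) → Ω n → ℝ)
    (hlaw : ∀ n, ∀ e ∈ (⊤ : SimpleGraph (Fin n)).edgeSet, HasLaw (X n e) (edgeLaw ρ α) (P n))
    (hindep : ∀ n, iIndepFun (fun e : (⊤ : SimpleGraph (Fin n)).edgeSet => X n (e : Sym2 (Fin n)))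
      (P n))
    (ε : ℕ → ℝ) (hε : ∀ n, 0 < ε n)
    (hε₁ : (fun n : ℕ => Real.log n ^ (-1 + 2 / α) * Real.log (Real.log n)) =o[atTop] ε)
    (hε₂ : (fun n : ℕ => Real.log n ^ (-1 / α) * Real.log (Real.log n) ^ 3) =o[atTop] ε) :
    Tendsto
      (fun n : ℕ => P n {ω | optimalWeight n (fun e => X n e ω) ≤
        (1 + ε n) * Real.exp 1 * (⌈sParam ρ α n * Real.log n⌉ : ℝ) * charScale (edgeLaw ρ α) n})
      atTop (𝓝 1) := by
  have hα0 : 0 < α := by linarith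
  have hL : Tendsto (fun n : ℕ => Real.log n) atTop atTop :=
    Real.tendsto_log_atTop.comp tendsto_natCast_atTop_atTop
  set M : ℕ → ℝ := fun n => (Real.log n / ρ) ^ (1 / α) with hMd
  have hM : Tendsto M atTop atTop :=
    (tendsto_rpow_atTop (by positivity)).comp (hL.atTop_div_const hρ)
  -- Capping at 1 keeps log(1+η) ≤ 1; the event only grows when η is replaced by ε.
  set η : ℕ → ℝ := fun n => min (ε n) 1 with hηd
  have hηM : Tendsto (fun n => η n * M n) atTop atTop := by
    have hεL : Tendsto (fun n : ℕ => ε n * Real.log n ^ (1 / α)) atTop atTop := by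
      have hLL := Real.tendsto_log_atTop.comp hL
      rw [tendsto_atTop]
      -- Once log log n ≥ 1 its cube can be dropped, so (log n)^(-1/α) = o(ε).
      intro B
      filter_upwards [hε₂.bound (show (0 : ℝ) < 1 / (|B| + 1) by positivity),
        hL.eventually_gt_atTop 0, hLL.eventually_ge_atTop 1] with n h1 h2 h3
      rw [Real.norm_of_nonneg (hε n).le, Function.comp_apply] at *
      have h4 : (0 : ℝ) < Real.log n ^ (1 / α) := by positivity
      have h5 : Real.log n ^ (-1 / α) ≤ 1 / (|B| + 1) * ε n := by
        refine le_trans ?_ ((Real.le_norm_self _).trans h1)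
        exact le_mul_of_one_le_right (by positivity) (one_le_pow₀ h3)
      rw [neg_div, Real.rpow_neg h2.le, inv_le_iff_one_le_mul₀ h4] at h5
      have h6 : |B| + 1 ≤ ε n * Real.log n ^ (1 / α) := by
        have h7 : 1 / (|B| + 1) * ε n * Real.log n ^ (1 / α) =
          ε n * Real.log n ^ (1 / α) / (|B| + 1) := by ring
        rw [h7, one_le_div (by positivity)] at h5
        exact h5
      linarith [le_abs_self B]
    have hεM : Tendsto (fun n => ε n * M n) atTop atTop := by
      refine (hεL.atTop_div_const (show 0 < ρ ^ (1 / α) by positivity)).congr' ?_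
      filter_upwards [hL.eventually_gt_atTop 0] with n h2
      rw [hMd]
      dsimp only
      rw [Real.div_rpow h2.le hρ.le, mul_div_assoc]
    rw [tendsto_atTop]
    intro B
    filter_upwards [hεM.eventually_ge_atTop B, hM.eventually_ge_atTop B,
      hM.eventually_ge_atTop 0] with n h1 h2 h3
    rw [hηd]
    dsimp only
    rw [min_mul_of_nonneg _ _ h3, one_mul]
    exact le_min h1 h2
  have hT : Tendsto (fun x : ℝ => ρ * x ^ (α - 1)) atTop atTop :=
    (tendsto_rpow_atTop (by linarith)).const_mul_atTop hρ
  -- This is where α > 2 is needed: log(2x) must be negligible against x^(α-2).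
  have hlog : ∀ᶠ x : ℝ in atTop, x * Real.log (2 * x) ≤ ρ * x ^ (α - 1) := by
    have h1 : (fun x : ℝ => Real.log (2 * x)) =o[atTop] fun x : ℝ => x ^ (α - 2) := by
      have h2 : Tendsto (fun x : ℝ => 2 * x) atTop atTop := tendsto_id.const_mul_atTop two_pos
      refine ((isLittleO_log_rpow_atTop (show 0 < α - 2 by linarith)).comp_tendsto h2).trans_isBigO
        (IsBigO.of_bound (2 ^ (α - 2)) ?_)
      filter_upwards [eventually_gt_atTop 0] with x hx
      rw [Function.comp_apply, Real.mul_rpow two_pos.le hx.le, norm_mul]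
      gcongr
      exact (Real.norm_of_nonneg (by positivity)).le
    filter_upwards [h1.bound hρ, eventually_gt_atTop 0] with x hx hx0
    rw [Real.norm_of_nonneg (show 0 ≤ x ^ (α - 2) by positivity)] at hx
    calc x * Real.log (2 * x) ≤ x * (ρ * x ^ (α - 2)) := by
          gcongr
          exact (Real.le_norm_self _).trans hx
      _ = ρ * (x ^ (α - 2) * x) := by ring
      _ = ρ * x ^ (α - 1) := by
          rw [← Real.rpow_add_one hx0.ne']
          ring_nf
  have hexp : ∀ᶠ x : ℝ in atTop, 10 * x ^ 2 ≤ Real.exp (ρ * x ^ α) := by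
    have h1 : (fun x : ℝ => x ^ 2) =o[atTop] Real.exp := Real.isLittleO_pow_exp_atTop
    filter_upwards [h1.bound (show (0 : ℝ) < 1 / 10 by norm_num), hT.eventually_ge_atTop 1,
      eventually_gt_atTop 0] with x hx h2 h3
    rw [Real.norm_of_nonneg (Real.exp_pos _).le, Real.norm_of_nonneg (by positivity)] at hx
    have h4 : x ≤ ρ * x ^ α := by
      have : ρ * x ^ α = ρ * x ^ (α - 1) * x := by
        rw [mul_assoc, ← Real.rpow_add_one h3.ne']
        ring_nf
      rw [this]
      exact le_mul_of_one_le_left h3.le h2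
    have := Real.exp_le_exp.2 h4
    linarith
  have herr : Tendsto (fun n => ENNReal.ofReal
      (1 - (Real.exp (-(ρ * M n ^ (α - 1) * (η n * M n / 2 - 4 * α - 1))) +
        10 / (ρ * M n ^ (α - 1))))) atTop (𝓝 1) := by
    have hTM := hT.comp hM
    have h1 : Tendsto (fun n => η n * M n / 2 - 4 * α - 1) atTop atTop := by
      have := tendsto_atTop_add_const_right atTop (-(4 * α) - 1) (hηM.atTop_div_const two_pos)
      refine this.congr fun n => by ring
    have h2 := Real.tendsto_exp_neg_atTop_nhds_zero.comp (hTM.atTop_mul_atTop₀ h1)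
    have h3 := hTM.const_div_atTop 10
    have h4 := ENNReal.tendsto_ofReal ((h2.add h3).const_sub 1)
    simpa [Function.comp_def] using h4
  refine tendsto_of_tendsto_of_tendsto_of_le_of_le' herr tendsto_const_nhds ?_
    (Eventually.of_forall fun n => prob_le_one)
  filter_upwards [hM.eventually_ge_atTop (2 * α), hηM.eventually_ge_atTop (8 * α + 2),
    (hT.comp hM).eventually_ge_atTop 1, hM.eventually hlog, hM.eventually hexp,
    hL.eventually_gt_atTop 0, eventually_ge_atTop 2] with n h1 h2 h3 h4 h5 h6 h7
  have hη0 : 0 ≤ η n := le_min (hε n).le zero_le_one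
  have hq : 0 < Real.log n / ρ := div_pos h6 hρ
  have hn : (n : ℝ) = Real.exp (ρ * M n ^ α) := by
    rw [hMd]
    dsimp only
    rw [one_div, Real.rpow_inv_rpow hq.le hα0.ne', mul_div_cancel₀ _ hρ.ne',
      Real.exp_log (by exact_mod_cast (by omega : 0 < n))]
  have hb := optimalWeight_prob_bound (P n) hρ hα (X n) (hlaw n) (hindep n) hn hη0
    (min_le_right _ _) h1 h2 h3 h4 h5
  refine (ENNReal.ofReal_le_ofReal hb).trans ?_
  rw [ofReal_measureReal]
  refine measure_mono fun ω hω => ?_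
  rw [Set.mem_ofPred_eq] at hω ⊢
  refine hω.trans ?_
  have hs : sParam ρ α n * Real.log n = M n / α := by
    rw [sParam, hMd]
    dsimp only
    rw [Real.div_rpow h6.le hρ.le, div_mul_eq_mul_div, add_comm, Real.rpow_add h6, Real.rpow_neg_one]
    field_simp
  rw [charScale_edgeLaw hρ hα0 h7, hs,
    ← natCast_ceil_eq_intCast_ceil (show 0 ≤ M n / α from div_nonneg (by linarith) hα0.le)]
  have he : Real.exp (-(M n - (1 + Real.log (1 + η n)))) =
      (1 + η n) * Real.exp 1 * Real.exp (-M n) := by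
    rw [show -(M n - (1 + Real.log (1 + η n))) = Real.log (1 + η n) + 1 + -M n by ring,
      Real.exp_add, Real.exp_add, Real.exp_log (by linarith)]
  rw [he]
  calc _ ≤ (⌈M n / α⌉₊ : ℝ) * ((1 + ε n) * Real.exp 1 * Real.exp (-M n)) := by
        gcongr
        exact min_le_left _ _
    _ = _ := by ring
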